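/- Let $d,n\in\mathbb N$ and let $M=[m_0,\dots,m_n]$ be a real $d\times(n+1)$ matrix whose columns are nonzero, span $\mathbb R^d$, and lie in an open half-space, i.e. there is $u\in\mathbb R^d$ with $u\cdot m_j>0$ for all $j$ (this holds in particular if the first nonzero component of every column is positive). Let $\pmb z=(z_0,\dots,z_n)\in\mathbb C^{n+1}$ with $\operatorname{Re}(z_j)>-1$ for all $j$. Let $t_+^z=t^z=e^{z\log t}$ for $t>0$ and $t_+^z=0$ for $t\le 0$, and let $\mathcal T_{\pmb z}(\cdot|M)$ be the multivariate truncated complex power, that is, the tempered distribution on $\mathbb R^d$ given by $$\langle \mathcal T_{\pmb z}(\cdot|M),\varphi\rangle=\int_{[0,\infty)^{n+1}}\ \prod_{j=0}^n\frac{(t_j)_+^{z_j}}{\Gamma(z_j+1)}\ \varphi(Mt)\,dt,\qquad \varphi\in\mathcal S(\mathbb R^d).$$ With the Fourier transform $\widehat\varphi(\omega)=\int_{\mathbb R^d}\varphi(x)e^{-i\omega\cdot x}\,dx$ on $\mathcal S(\mathbb R^d)$ and $\langle\widehat T,\varphi\rangle=\langle T,\widehat\varphi\rangle$ on tempered distributions,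 the Fourier transform of $\mathcal T_{\pmb z}(\cdot|M)$ is the tempered distribution $$\prod_{j=0}^n\frac{1}{(i\omega\cdot m_j)^{z_j+1}},$$ where powers are principal and, since this function need not be locally integrable near the hyperplanes $\omega\cdot m_j=0$, the distribution is understood as the boundary value from the right half-plane in each factor: for every $\varphi\in\mathcal S(\mathbb R^d)$, $$\langle\widehat{\mathcal T_{\pmb z}}(\cdot|M),\varphi\rangle=\lim_{\varepsilon\to 0,\ \varepsilon_0,\dots,\varepsilon_n>0}\ \int_{\mathbb R^d}\prod_{j=0}^n\frac{1}{(\varepsilon_j+i\omega\cdot m_j)^{z_j+1}}\ \varphi(\omega)\,d\omega .$$ Moreover, for every $\varphi\in\mathcal S(\mathbb R^d)$ such that $\prod_{j=0}^n(i\omega\cdot m_j)^{-(z_j+1)}\varphi(\omega)$ is integrable over $\mathbb R^d$, $$\langle\widehat{\mathcal T_{\pmb z}}(\cdot|M),\varphi\rangle=\int_{\mathbb R^d}\prod_{j=0}^n\frac{1}{(i\omega\cdot m_j)^{z_j+1}}\ \varphi(\omega)\,d\omega .$$ -/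

import Mathlib

open MeasureTheory Filter Topology SchwartzMap
open scoped FourierTransform

namespace ComplexBoxSpline

noncomputable section

/-- The `j`-th column `m_j` of `M`, as a vector of the Euclidean space `ℝ^d`. -/
def dir {d n : ℕ} (M : Matrix (Fin d) (Fin (n + 1)) ℝ) (j : Fin (n + 1)) :
    EuclideanSpace ℝ (Fin d) :=
  WithLp.toLp 2 (M.col j)

/-- The vector `M t` of the Euclidean space `ℝ^d`. -/
def mulV {d n : ℕ} (M : Matrix (Fin d) (Fin (n + 1)) ℝ) (t : Fin (n + 1) → ℝ) :
    EuclideanSpace ℝ (Fin d) :=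
  WithLp.toLp 2 (M.mulVec t)

/-- The columns of `M` form a direction set: they are nonzero and span `ℝ^d`. -/
structure IsDirectionSet {d n : ℕ} (M : Matrix (Fin d) (Fin (n + 1)) ℝ) : Prop where
  ne_zero : ∀ j, dir M j ≠ 0
  span_eq_top : Submodule.span ℝ (Set.range (dir M)) = ⊤

/-- The columns of `M` lie in an open half-space, i.e. the cone which they generate is pointed.
This is what makes the integral of a Schwartz function over the cone converge. -/
def InOpenHalfSpace {d n : ℕ} (M : Matrix (Fin d) (Fin (n + 1)) ℝ) : Prop :=
  ∃ u : EuclideanSpace ℝ (Fin d), ∀ j, 0 < inner ℝ u (dir M j)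

/-- The first nonzero component of each column of `M` is positive. -/
def FirstNonzeroPos {d n : ℕ} (M : Matrix (Fin d) (Fin (n + 1)) ℝ) : Prop :=
  ∀ j, ∃ i, 0 < M i j ∧ ∀ i' < i, M i' j = 0

/-- The truncated complex power `t_+^z`. -/
def truncPow (z : ℂ) (t : ℝ) : ℂ := if 0 < t then (t : ℂ) ^ z else 0

/-- The kernel `k_z(t) = ∏_j (t_j)_+^{z_j} / Γ(z_j + 1)`. -/
def kernelK {n : ℕ} (z : Fin (n + 1) → ℂ) (t : Fin (n + 1) → ℝ) : ℂ :=
  ∏ j, truncPow (z j) (t j) / Complex.Gamma (z j + 1)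

/-! ### Scalar product with a direction, and the two forms of the half-space condition -/

theorem inner_dir {d n : ℕ} (M : Matrix (Fin d) (Fin (n + 1)) ℝ)
    (w : EuclideanSpace ℝ (Fin d)) (j : Fin (n + 1)) :
    inner ℝ w (dir M j) = ∑ i, w i * M i j := by
  simp [dir, PiLp.inner_apply, mul_comm, Matrix.col]

theorem inner_mulV {d n : ℕ} (M : Matrix (Fin d) (Fin (n + 1)) ℝ)
    (w : EuclideanSpace ℝ (Fin d)) (t : Fin (n + 1) → ℝ) :
    inner ℝ w (mulV M t) = ∑ j, t j * inner ℝ w (dir M j) := by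
  simp only [inner_dir, Finset.mul_sum]
  rw [Finset.sum_comm]
  simp only [mulV, PiLp.inner_apply, Matrix.mulVec, dotProduct]
  refine Finset.sum_congr rfl fun i _ => ?_
  simp only [RCLike.inner_apply, conj_trivial, Finset.sum_mul]
  refine Finset.sum_congr rfl fun j _ => ?_
  ring

theorem FirstNonzeroPos.inOpenHalfSpace {d n : ℕ} {M : Matrix (Fin d) (Fin (n + 1)) ℝ}
    (h : FirstNonzeroPos M) : InOpenHalfSpace M := by
  have key : ∀ᶠ δ : ℝ in 𝓝[>] 0, ∀ j, 0 < ∑ i : Fin d, δ ^ (i : ℕ) * M i j := by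
    rw [Filter.eventually_all]
    intro j
    obtain ⟨i, hi, hlt⟩ := h j
    have hcont : Tendsto (fun δ : ℝ => ∑ i' : Fin d, δ ^ ((i' : ℕ) - (i : ℕ)) *
        (if i ≤ i' then M i' j else 0)) (𝓝[>] 0)
        (𝓝 (∑ i' : Fin d, (0 : ℝ) ^ ((i' : ℕ) - (i : ℕ)) * (if i ≤ i' then M i' j else 0))) := by
      refine tendsto_nhdsWithin_of_tendsto_nhds ?_
      have : Continuous (fun δ : ℝ => ∑ i' : Fin d, δ ^ ((i' : ℕ) - (i : ℕ)) *
        (if i ≤ i' then M i' j else 0)) := by fun_prop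
      exact this.tendsto 0
    have hval : (∑ i' : Fin d, (0 : ℝ) ^ ((i' : ℕ) - (i : ℕ)) * (if i ≤ i' then M i' j else 0))
        = M i j := by
      rw [Finset.sum_eq_single i]
      · simp
      · intro b _ hb
        by_cases hib : i ≤ b
        · have : (b : ℕ) - (i : ℕ) ≠ 0 := by
            have : (i : ℕ) < b := lt_of_le_of_ne hib (fun e => hb (Fin.ext e.symm))
            omega
          simp [this]
        · simp [hib]
      · simp
    rw [hval] at hcont
    filter_upwards [hcont.eventually (lt_mem_nhds hi), self_mem_nhdsWithin] with δ h1 h2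
    have h2' : (0 : ℝ) < δ := h2
    have : ∑ i' : Fin d, δ ^ (i' : ℕ) * M i' j = δ ^ (i : ℕ) *
        ∑ i' : Fin d, δ ^ ((i' : ℕ) - (i : ℕ)) * (if i ≤ i' then M i' j else 0) := by
      rw [Finset.mul_sum]
      refine Finset.sum_congr rfl fun b _ => ?_
      by_cases hib : i ≤ b
      · have hle : (i : ℕ) ≤ b := hib
        rw [if_pos hib, ← mul_assoc, ← pow_add, Nat.add_sub_cancel' hle]
      · rw [if_neg hib, hlt b (not_le.mp hib)]; simp
    rw [this]
    positivity
  obtain ⟨δ, hδ⟩ := key.exists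
  refine ⟨WithLp.toLp 2 fun i => δ ^ (i : ℕ), fun j => ?_⟩
  rw [inner_dir]
  exact hδ j

/-! ### The multivariate truncated complex power is a tempered distribution -/

theorem truncPow_norm (z : ℂ) (t : ℝ) : ‖truncPow z t‖ = if 0 < t then t ^ z.re else 0 := by
  unfold truncPow
  split_ifs with h
  · exact Complex.norm_cpow_eq_rpow_re_of_pos h z
  · simp

theorem measurable_truncPow (z : ℂ) : Measurable (truncPow z) := by
  unfold truncPow
  refine Measurable.ite measurableSet_Ioi ?_ measurable_const
  exact (Complex.measurable_ofReal).pow_const z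

theorem measurable_kernelK {n : ℕ} (z : Fin (n + 1) → ℂ) : Measurable (kernelK z) := by
  unfold kernelK
  refine Finset.measurable_prod _ fun j _ => ?_
  exact ((measurable_truncPow (z j)).comp (measurable_pi_apply j)).div_const _

theorem integrable_truncPow_mul {z : ℂ} (hz : -1 < z.re) {K : ℕ} (hK : z.re + 1 < K) :
    Integrable (fun s : ℝ => ‖truncPow z s‖ * ((1 + |s|) ^ K)⁻¹) := by
  have hmeas : Measurable (fun s : ℝ => ‖truncPow z s‖ * ((1 + |s|) ^ K)⁻¹) := by
    have := measurable_truncPow z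
    fun_prop
  have h0 : IntegrableOn (fun s : ℝ => ‖truncPow z s‖ * ((1 + |s|) ^ K)⁻¹) (Set.Iic 0) := by
    refine (integrableOn_zero (μ := volume)).congr_fun (fun s hs => ?_) measurableSet_Iic
    simp [truncPow_norm, not_lt.mpr (Set.mem_Iic.mp hs)]
  have h1 : IntegrableOn (fun s : ℝ => ‖truncPow z s‖ * ((1 + |s|) ^ K)⁻¹) (Set.Ioc 0 1) := by
    have := (intervalIntegrable_iff_integrableOn_Ioc_of_le (zero_le_one' ℝ)).mp
      (intervalIntegral.intervalIntegrable_rpow' hz (a := 0) (b := 1))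
    refine Integrable.mono' this hmeas.aestronglyMeasurable ?_
    filter_upwards [ae_restrict_mem measurableSet_Ioc] with s hs
    rw [truncPow_norm, if_pos hs.1, Real.norm_of_nonneg
      (mul_nonneg (Real.rpow_nonneg hs.1.le _) (by positivity))]
    refine mul_le_of_le_one_right (Real.rpow_nonneg hs.1.le _) (inv_le_one_of_one_le₀ ?_)
    exact one_le_pow₀ (by linarith [abs_nonneg s])
  have h2 : IntegrableOn (fun s : ℝ => ‖truncPow z s‖ * ((1 + |s|) ^ K)⁻¹) (Set.Ioi 1) := by
    have := integrableOn_Ioi_rpow_of_lt (a := z.re - K) (c := 1) (by linarith) one_pos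
    refine Integrable.mono' this hmeas.aestronglyMeasurable ?_
    filter_upwards [ae_restrict_mem measurableSet_Ioi] with s hs
    have hs0 : (0 : ℝ) < s := lt_trans one_pos hs
    rw [truncPow_norm, if_pos hs0, Real.norm_of_nonneg
      (mul_nonneg (Real.rpow_nonneg hs0.le _) (by positivity)), Real.rpow_sub hs0,
      Real.rpow_natCast, div_eq_mul_inv]
    refine mul_le_mul_of_nonneg_left ?_ (Real.rpow_nonneg hs0.le _)
    refine inv_anti₀ (by positivity) (pow_le_pow_left₀ hs0.le ?_ _)
    rw [abs_of_pos hs0]; linarith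
  rw [← integrableOn_univ, ← Set.Iic_union_Ioi (a := (0 : ℝ)),
    ← Set.Ioc_union_Ioi_eq_Ioi (zero_le_one' ℝ)]
  exact h0.union (h1.union h2)

theorem exists_one_add_sum_le {d n : ℕ} {M : Matrix (Fin d) (Fin (n + 1)) ℝ}
    (hM : InOpenHalfSpace M) :
    ∃ C : ℝ, 0 < C ∧ ∀ t : Fin (n + 1) → ℝ, (∀ j, 0 ≤ t j) →
      1 + ∑ j, t j ≤ C * (1 + ‖mulV M t‖) := by
  obtain ⟨u, hu⟩ := hM
  obtain ⟨j₀, -, hj₀⟩ := Finset.exists_min_image Finset.univ (fun j => inner ℝ u (dir M j))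
    Finset.univ_nonempty
  set c := inner ℝ u (dir M j₀) with hc
  have hc0 : 0 < c := hu j₀
  refine ⟨1 + ‖u‖ / c, by positivity, fun t ht => ?_⟩
  have h1 : c * ∑ j, t j ≤ ‖u‖ * ‖mulV M t‖ := by
    refine le_trans ?_ (real_inner_le_norm u (mulV M t))
    rw [inner_mulV, Finset.mul_sum]
    refine Finset.sum_le_sum fun j _ => ?_
    rw [mul_comm]
    exact mul_le_mul_of_nonneg_left (hj₀ j (Finset.mem_univ j)) (ht j)
  have h2 : ∑ j, t j ≤ ‖u‖ / c * ‖mulV M t‖ := by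
    rw [div_mul_eq_mul_div, le_div_iff₀ hc0]; linarith
  have h3 : 0 ≤ ‖u‖ / c := by positivity
  nlinarith [norm_nonneg (mulV M t)]

theorem continuous_mulV {d n : ℕ} (M : Matrix (Fin d) (Fin (n + 1)) ℝ) :
    Continuous (mulV M) := by
  unfold mulV
  refine (PiLp.continuous_toLp 2 _).comp ?_
  exact Continuous.matrix_mulVec continuous_const continuous_id

/-- Domination of `k_z(t) φ(Mt)` by an integrable function times a Schwartz seminorm of `φ`. -/
theorem kernelK_bound {d n : ℕ} {M : Matrix (Fin d) (Fin (n + 1)) ℝ}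
    (hM : InOpenHalfSpace M) {z : Fin (n + 1) → ℂ} (hz : ∀ j, -1 < (z j).re) :
    ∃ (N : ℕ) (g : (Fin (n + 1) → ℝ) → ℝ), Integrable g ∧ (∀ t, 0 ≤ g t) ∧
      ∀ (φ : 𝓢(EuclideanSpace ℝ (Fin d), ℂ)) (t : Fin (n + 1) → ℝ),
        ‖kernelK z t * φ (mulV M t)‖ ≤ g t *
          (Finset.Iic (N, 0)).sup (schwartzSeminormFamily ℂ (EuclideanSpace ℝ (Fin d)) ℂ) φ := by
  obtain ⟨C, hC, hCt⟩ := exists_one_add_sum_le hM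
  obtain ⟨K, hK⟩ := exists_nat_gt (∑ j, ((z j).re + 1))
  have hK' : ∀ j, (z j).re + 1 < K := fun j => lt_of_le_of_lt
    (Finset.single_le_sum (f := fun j => (z j).re + 1)
      (fun i _ => by linarith [hz i]) (Finset.mem_univ j)) hK
  set N := (n + 1) * K with hN
  refine ⟨N, fun t => (2 ^ N * C ^ N) * ∏ j, ((‖truncPow (z j) (t j)‖ * ((1 + |t j|) ^ K)⁻¹) *
    ‖Complex.Gamma (z j + 1)‖⁻¹), ?_, fun t => by positivity, fun φ t => ?_⟩
  · refine Integrable.const_mul ?_ _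
    exact Integrable.fintype_prod (f := fun j (s : ℝ) =>
      (‖truncPow (z j) s‖ * ((1 + |s|) ^ K)⁻¹) * ‖Complex.Gamma (z j + 1)‖⁻¹)
      fun j => (integrable_truncPow_mul (hz j) (hK' j)).mul_const _
  · set S := (Finset.Iic (N, 0)).sup
      (schwartzSeminormFamily ℂ (EuclideanSpace ℝ (Fin d)) ℂ) φ with hS
    have hS0 : 0 ≤ S := apply_nonneg _ _
    by_cases ht : ∀ j, 0 < t j
    swap
    · push Not at ht
      obtain ⟨j, hj⟩ := ht
      have : kernelK z t = 0 := by
        refine Finset.prod_eq_zero (Finset.mem_univ j) ?_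
        simp [truncPow, not_lt.mpr hj]
      rw [this, zero_mul, norm_zero]
      exact mul_nonneg (by positivity) hS0
    have hφ : (1 + ‖mulV M t‖) ^ N * ‖φ (mulV M t)‖ ≤ 2 ^ N * S := by
      have := one_add_le_sup_seminorm_apply (𝕜 := ℂ) (m := (N, 0)) (k := N) (n := 0)
        le_rfl le_rfl φ (mulV M t)
      rw [norm_iteratedFDeriv_zero] at this
      exact this
    have hprod : ∏ j, (1 + |t j|) ^ K ≤ C ^ N * (1 + ‖mulV M t‖) ^ N := by
      rw [← mul_pow, hN, pow_mul, Finset.prod_pow]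
      refine pow_le_pow_left₀ (by positivity) ?_ K
      refine le_trans ?_ (pow_le_pow_left₀ ?_ (hCt t fun j => (ht j).le) (n + 1))
      · calc ∏ j, (1 + |t j|) ≤ ∏ _j : Fin (n + 1), (1 + ∑ j, t j) := by
              refine Finset.prod_le_prod (fun j _ => by positivity) fun j _ => ?_
              rw [abs_of_pos (ht j)]
              have := Finset.single_le_sum (f := t) (fun i _ => (ht i).le) (Finset.mem_univ j)
              linarith
          _ = _ := by simp
      · have := Finset.sum_nonneg (f := t) (s := Finset.univ) fun i _ => (ht i).le
        linarith
    have hP : 0 < ∏ j, (1 + |t j|) ^ K := Finset.prod_pos fun j _ => by positivity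
    have hmain : ‖φ (mulV M t)‖ ≤ (2 ^ N * C ^ N) * (∏ j, ((1 + |t j|) ^ K)⁻¹) * S := by
      rw [Finset.prod_inv_distrib, mul_right_comm, ← div_eq_mul_inv, le_div_iff₀ hP]
      calc ‖φ (mulV M t)‖ * ∏ j, (1 + |t j|) ^ K
          ≤ ‖φ (mulV M t)‖ * (C ^ N * (1 + ‖mulV M t‖) ^ N) :=
            mul_le_mul_of_nonneg_left hprod (norm_nonneg _)
        _ = C ^ N * ((1 + ‖mulV M t‖) ^ N * ‖φ (mulV M t)‖) := by ring
        _ ≤ C ^ N * (2 ^ N * S) := mul_le_mul_of_nonneg_left hφ (by positivity)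
        _ = _ := by ring
    have hk : ‖kernelK z t‖ = ∏ j, (‖truncPow (z j) (t j)‖ * ‖Complex.Gamma (z j + 1)‖⁻¹) := by
      unfold kernelK
      rw [norm_prod]
      simp [div_eq_mul_inv]
    rw [norm_mul, hk]
    refine (mul_le_mul_of_nonneg_left hmain (by positivity)).trans (le_of_eq ?_)
    simp only [Finset.prod_mul_distrib]
    ring

theorem integrable_kernelK {d n : ℕ} {M : Matrix (Fin d) (Fin (n + 1)) ℝ}
    (hM : InOpenHalfSpace M) {z : Fin (n + 1) → ℂ} (hz : ∀ j, -1 < (z j).re)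
    (φ : 𝓢(EuclideanSpace ℝ (Fin d), ℂ)) :
    Integrable (fun t : Fin (n + 1) → ℝ => kernelK z t * φ (mulV M t)) := by
  obtain ⟨N, g, hg, -, hb⟩ := kernelK_bound hM hz
  refine Integrable.mono' (hg.mul_const _) ?_ (Filter.Eventually.of_forall (hb φ))
  exact ((measurable_kernelK z).mul
    (φ.continuous.comp (continuous_mulV M)).measurable).aestronglyMeasurable

/-- The multivariate truncated complex power `T_z(· | M)`: the tempered distribution
`φ ↦ ∫_{ℝ₊^{n+1}} k_z(t) φ(M t) dt`. -/
def truncPowDist {d n : ℕ} (M : Matrix (Fin d) (Fin (n + 1)) ℝ) (hM : InOpenHalfSpace M)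
    (z : Fin (n + 1) → ℂ) (hz : ∀ j, -1 < (z j).re) : 𝓢'(EuclideanSpace ℝ (Fin d), ℂ) :=
  ContinuousLinearMap.toPointwiseConvergenceCLM ℂ (RingHom.id ℂ) _ _ <|
    SchwartzMap.mkCLMtoNormedSpace (𝕜 := ℂ) (σ := RingHom.id ℂ)
      (fun φ : 𝓢(EuclideanSpace ℝ (Fin d), ℂ) =>
        ∫ t in {t : Fin (n + 1) → ℝ | ∀ j, 0 ≤ t j}, kernelK z t * φ (mulV M t))
      (fun φ ψ => by
        rw [← integral_add (integrable_kernelK hM hz φ).integrableOn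
          (integrable_kernelK hM hz ψ).integrableOn]
        simp [mul_add])
      (fun a φ => by
        rw [RingHom.id_apply, smul_eq_mul, ← integral_const_mul]
        simp [mul_left_comm])
      (by
        obtain ⟨N, g, hg, hg0, hb⟩ := kernelK_bound hM hz
        refine ⟨Finset.Iic (N, 0), ∫ t, g t, integral_nonneg hg0, fun φ => ?_⟩
        rw [← integral_mul_const]
        refine (norm_integral_le_of_norm_le (hg.mul_const _).integrableOn
          (Filter.Eventually.of_forall (hb φ))).trans ?_
        refine setIntegral_le_integral (hg.mul_const _) (Filter.Eventually.of_forall fun t => ?_)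
        exact mul_nonneg (hg0 t) (apply_nonneg _ _))

theorem truncPowDist_apply {d n : ℕ} (M : Matrix (Fin d) (Fin (n + 1)) ℝ)
    (hM : InOpenHalfSpace M) (z : Fin (n + 1) → ℂ) (hz : ∀ j, -1 < (z j).re)
    (φ : 𝓢(EuclideanSpace ℝ (Fin d), ℂ)) :
    truncPowDist M hM z hz φ =
      ∫ t in {t : Fin (n + 1) → ℝ | ∀ j, 0 ≤ t j}, kernelK z t * φ (mulV M t) := rfl

/-! ### The Fourier transform with kernel `exp (-i ω · x)` -/

/-- The dilation `x ↦ x / (2π)`. -/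
def dilation (d : ℕ) : EuclideanSpace ℝ (Fin d) ≃L[ℝ] EuclideanSpace ℝ (Fin d) :=
  ContinuousLinearEquiv.smulLeft (Units.mk0 ((2 * Real.pi)⁻¹ : ℝ) (by positivity))

/-- The Fourier transform `φ̂(ω) = ∫ φ(x) exp (-i ω · x) dx` on Schwartz functions. -/
def fourierS (d : ℕ) :
    𝓢(EuclideanSpace ℝ (Fin d), ℂ) →L[ℂ] 𝓢(EuclideanSpace ℝ (Fin d), ℂ) :=
  SchwartzMap.compCLMOfContinuousLinearEquiv ℂ (dilation d) ∘L
    FourierTransform.fourierCLM ℂ 𝓢(EuclideanSpace ℝ (Fin d), ℂ)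

theorem fourierS_apply {d : ℕ} (φ : 𝓢(EuclideanSpace ℝ (Fin d), ℂ))
    (w : EuclideanSpace ℝ (Fin d)) :
    fourierS d φ w = ∫ x, φ x * Complex.exp (-Complex.I * (inner ℝ w x : ℝ)) := by
  have h : fourierS d φ w = (𝓕 φ) ((2 * Real.pi)⁻¹ • w) := rfl
  rw [h, SchwartzMap.fourier_coe, Real.fourier_eq']
  refine integral_congr_ae (Filter.Eventually.of_forall fun x => ?_)
  simp only [smul_eq_mul]
  rw [mul_comm, inner_smul_right, real_inner_comm]
  congr 2
  have : (-2 * Real.pi * ((2 * Real.pi)⁻¹ * inner ℝ w x)) = -inner ℝ w x := by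
    field_simp
  rw [this]
  push_cast
  ring

/-- The Fourier transform of a tempered distribution, `⟨T̂, φ⟩ = ⟨T, φ̂⟩`. -/
def fourierD {d : ℕ} (T : 𝓢'(EuclideanSpace ℝ (Fin d), ℂ)) :
    𝓢'(EuclideanSpace ℝ (Fin d), ℂ) :=
  PointwiseConvergenceCLM.precomp ℂ (fourierS d) T

theorem fourierD_apply {d : ℕ} (T : 𝓢'(EuclideanSpace ℝ (Fin d), ℂ))
    (φ : 𝓢(EuclideanSpace ℝ (Fin d), ℂ)) : fourierD T φ = T (fourierS d φ) := rfl

/-! ### The distribution `∏_j (i ω · m_j)^{-(z_j + 1)}` -/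

/-- The function `ω ↦ ∏_j (ε_j + i ω · m_j)^{-(z_j + 1)}`, with principal powers. -/
def cpowProd {d n : ℕ} (M : Matrix (Fin d) (Fin (n + 1)) ℝ) (z : Fin (n + 1) → ℂ)
    (ε : Fin (n + 1) → ℝ) (w : EuclideanSpace ℝ (Fin d)) : ℂ :=
  ∏ j, ((ε j : ℂ) + Complex.I * (inner ℝ w (dir M j) : ℝ)) ^ (-(z j + 1))

/-- `F` is the tempered distribution `∏_j (i ω · m_j)^{-(z_j + 1)}`. The function given by this
formula need not be locally integrable at the hyperplanes `ω · m_j = 0`; as for the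
one-dimensional distribution `(i ω + 0)^{-(z + 1)}`, each base is approached from the right
half-plane, and the distribution is the limit of the bounded functions
`∏_j (ε_j + i ω · m_j)^{-(z_j + 1)}` as all `ε_j > 0` tend to `0`. -/
def IsCpowProdDist {d n : ℕ} (M : Matrix (Fin d) (Fin (n + 1)) ℝ) (z : Fin (n + 1) → ℂ)
    (F : 𝓢'(EuclideanSpace ℝ (Fin d), ℂ)) : Prop :=
  ∀ φ : 𝓢(EuclideanSpace ℝ (Fin d), ℂ),
    Tendsto (fun ε : Fin (n + 1) → ℝ => ∫ w, cpowProd M z ε w * φ w)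
      (𝓝[{ε | ∀ j, 0 < ε j}] 0) (𝓝 (F φ))

/-- The approximating integrals converge absolutely. -/
theorem integrable_cpowProd {d n : ℕ} (M : Matrix (Fin d) (Fin (n + 1)) ℝ)
    (z : Fin (n + 1) → ℂ) (hz : ∀ j, -1 < (z j).re) {ε : Fin (n + 1) → ℝ} (hε : ∀ j, 0 < ε j)
    (φ : 𝓢(EuclideanSpace ℝ (Fin d), ℂ)) : Integrable (fun w => cpowProd M z ε w * φ w) := by
  have hre : ∀ (w : EuclideanSpace ℝ (Fin d)) j,
      ((ε j : ℂ) + Complex.I * (inner ℝ w (dir M j) : ℝ)).re = ε j := fun w j => by simp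
  have hcont : Continuous (cpowProd M z ε) := by
    unfold cpowProd
    refine continuous_finsetProd _ fun j _ => ?_
    refine Continuous.cpow (by fun_prop) continuous_const fun w => Or.inl ?_
    rw [hre]; exact hε j
  refine φ.integrable.bdd_mul (c := ∏ j, (ε j ^ (-((z j).re + 1)) *
    Real.exp (Real.pi * |(z j).im|))) hcont.aestronglyMeasurable
    (Filter.Eventually.of_forall fun w => ?_)
  unfold cpowProd
  rw [norm_prod]
  refine Finset.prod_le_prod (fun _ _ => norm_nonneg _) fun j _ => ?_
  set b := (ε j : ℂ) + Complex.I * (inner ℝ w (dir M j) : ℝ) with hb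
  have hbre : ε j ≤ ‖b‖ := by
    have := Complex.re_le_norm b
    rwa [hre] at this
  have hb0 : b ≠ 0 := norm_pos_iff.mp (lt_of_lt_of_le (hε j) hbre)
  rw [Complex.norm_cpow_of_ne_zero hb0, div_eq_mul_inv, ← Real.exp_neg]
  refine mul_le_mul ?_ ?_ (Real.exp_pos _).le (Real.rpow_nonneg (hε j).le _)
  · simp only [Complex.neg_re, Complex.add_re, Complex.one_re]
    exact Real.rpow_le_rpow_of_nonpos (hε j) hbre (by linarith [hz j])
  · rw [Real.exp_le_exp]
    simp only [Complex.neg_im, Complex.add_im, Complex.one_im, add_zero, mul_neg, neg_neg]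
    calc b.arg * (z j).im ≤ |b.arg * (z j).im| := le_abs_self _
      _ = |b.arg| * |(z j).im| := abs_mul _ _
      _ ≤ _ := mul_le_mul_of_nonneg_right (Complex.abs_arg_le_pi b) (abs_nonneg _)

/-- There is at most one such distribution. -/
theorem IsCpowProdDist.unique {d n : ℕ} {M : Matrix (Fin d) (Fin (n + 1)) ℝ}
    {z : Fin (n + 1) → ℂ} {F G : 𝓢'(EuclideanSpace ℝ (Fin d), ℂ)}
    (hF : IsCpowProdDist M z F) (hG : IsCpowProdDist M z G) : F = G := by
  have : (𝓝[{ε : Fin (n + 1) → ℝ | ∀ j, 0 < ε j}] 0).NeBot := by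
    rw [← mem_closure_iff_nhdsWithin_neBot]
    have h : {ε : Fin (n + 1) → ℝ | ∀ j, 0 < ε j} = Set.univ.pi fun _ => Set.Ioi 0 := by
      ext; simp
    rw [h, closure_pi_set]
    exact fun j _ => by rw [closure_Ioi]; exact Set.mem_Ici.mpr le_rfl
  ext φ
  exact tendsto_nhds_unique (hF φ) (hG φ)

end

end ComplexBoxSpline

/-!
For `Re b > 0` and `Re z > -1`, Euler's integral, continued analytically from `b > 0`, gives
`∫ t_+^z / Γ(z + 1) * exp (-b t) dt = b ^ (-(z + 1))`. Taking the product over the columns with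
`b_j = ε_j + i ω · m_j` exhibits the regularised symbol `cpowProd M z ε` as a Laplace transform of
the kernel `kernelK z` (`integral_kernelK_mul_exp`). The damping factor `exp (-∑ ε_j t_j)` makes
the double integral against a Schwartz function absolutely convergent, so that Fubini's theorem
turns `∫ cpowProd M z ε φ` into `∫ kernelK z t exp (-∑ ε_j t_j) φ̂(M t) dt`
(`integral_cpowProd_mul`). As `ε → 0` the damping disappears by dominated convergence, the
dominating function being `‖kernelK z t φ̂(M t)‖`, which is integrable because the columns lie in
an open half-space (`tendsto_integral_kernelK_mul_exp`).

For the second claim, `|ε + i s| ≥ |s|` and `Re (z + 1) > 0` show that `‖(ε + i s) ^ (-(z + 1))‖`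
is at most a constant times `‖(i s) ^ (-(z + 1))‖`, uniformly in `ε` (`norm_cpowProd_le`). Hence,
if the unregularised integrand is integrable, a multiple of its norm dominates the regularised
integrands, which converge to it off the hyperplanes `ω · m_j = 0`; these are null sets because
the columns are nonzero. The same integrals have only one limit, so the two expressions agree.
-/

namespace ComplexBoxSpline

/-! ### The Laplace transform of the kernel -/

theorem differentiableAt_integral_cpow_mul_exp_neg_mul_Ioi {a b : ℂ} (ha : 0 < a.re)
    (hb : 0 < b.re) :
    DifferentiableAt ℂ
      (fun b : ℂ => ∫ s in Set.Ioi (0 : ℝ), (s : ℂ) ^ (a - 1) * Complex.exp (-(b * s))) b := by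
  have hmeas : ∀ c : ℂ, AEStronglyMeasurable
      (fun s : ℝ => (s : ℂ) ^ (a - 1) * Complex.exp (-(c * s)))
      (volume.restrict (Set.Ioi 0)) := fun c => by
    refine Measurable.aestronglyMeasurable ?_
    exact ((Complex.measurable_ofReal).pow_const _).mul (Continuous.measurable (by fun_prop))
  have hnorm : ∀ (c : ℂ) {s : ℝ}, 0 < s →
      ‖(s : ℂ) ^ (a - 1) * Complex.exp (-(c * s))‖ = s ^ (a.re - 1) * Real.exp (-c.re * s) := by
    intro c s hs
    rw [norm_mul, Complex.norm_cpow_eq_rpow_re_of_pos hs, Complex.norm_exp]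
    simp
  have hreal : ∀ {p q : ℝ}, -1 < p → 0 < q →
      IntegrableOn (fun s : ℝ => s ^ p * Real.exp (-q * s)) (Set.Ioi 0) := by
    intro p q hp hq
    simpa using integrableOn_rpow_mul_exp_neg_mul_rpow (p := 1) hp one_pos hq
  refine (hasDerivAt_integral_of_dominated_loc_of_deriv_le (𝕜 := ℂ)
    (F' := fun c (s : ℝ) => (s : ℂ) ^ (a - 1) * Complex.exp (-(c * s)) * (-s))
    (bound := fun s : ℝ => s ^ a.re * Real.exp (-(b.re / 2) * s))
    (Metric.ball_mem_nhds b (half_pos hb)) (Eventually.of_forall hmeas) ?_ ?_ ?_ ?_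
    ?_).2.differentiableAt
  · refine (hreal (p := a.re - 1) (by linarith) hb).mono' (hmeas b) ?_
    filter_upwards [ae_restrict_mem measurableSet_Ioi] with s hs
    exact (hnorm b hs).le
  · exact (hmeas b).mul (Continuous.aestronglyMeasurable (by fun_prop))
  · filter_upwards [ae_restrict_mem measurableSet_Ioi] with s hs c hc
    have hs' : 0 < s := hs
    have hre : b.re / 2 ≤ c.re := by
      have h1 := (Complex.abs_re_le_norm (c - b)).trans (mem_ball_iff_norm.mp hc).le
      rw [Complex.sub_re] at h1
      linarith [(abs_le.mp h1).1]
    rw [norm_mul, hnorm c hs', norm_neg, Complex.norm_of_nonneg hs'.le, mul_right_comm]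
    have h2 : s ^ (a.re - 1) * s = s ^ a.re := by
      rw [Real.rpow_sub_one hs'.ne', div_mul_cancel₀ _ hs'.ne']
    rw [h2]
    gcongr
  · exact hreal (by linarith) (half_pos hb)
  · refine Eventually.of_forall fun s c _ => ?_
    have h : HasDerivAt (fun c : ℂ => -(c * s)) (-(s : ℂ)) c := by
      simpa using (hasDerivAt_mul_const (s : ℂ) (x := c)).fun_neg
    simpa only [mul_assoc] using h.cexp.const_mul ((s : ℂ) ^ (a - 1))

/-- `∫₀^∞ s ^ (a - 1) exp (-b s) ds = Γ(a) b ^ (-a)` for complex `b` in the right half-plane: both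
sides are holomorphic in `b` and agree for `b > 0`. -/
theorem integral_cpow_mul_exp_neg_mul_Ioi_of_re_pos {a b : ℂ} (ha : 0 < a.re) (hb : 0 < b.re) :
    ∫ s in Set.Ioi (0 : ℝ), (s : ℂ) ^ (a - 1) * Complex.exp (-(b * s)) =
      b ^ (-a) * Complex.Gamma a := by
  set U : Set ℂ := {b | 0 < b.re} with hU
  have hUo : IsOpen U := isOpen_lt continuous_const Complex.continuous_re
  have hUc : IsPreconnected U := (convex_halfSpace_re_gt 0).isPreconnected
  have hl : AnalyticOnNhd ℂ
      (fun b : ℂ => ∫ s in Set.Ioi (0 : ℝ), (s : ℂ) ^ (a - 1) * Complex.exp (-(b * s))) U :=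
    DifferentiableOn.analyticOnNhd (fun c hc =>
      (differentiableAt_integral_cpow_mul_exp_neg_mul_Ioi ha hc).differentiableWithinAt) hUo
  have hr : AnalyticOnNhd ℂ (fun b : ℂ => b ^ (-a) * Complex.Gamma a) U :=
    DifferentiableOn.analyticOnNhd (fun c hc => ((differentiableAt_id.cpow
      (differentiableAt_const (-a)) (Complex.mem_slitPlane_iff.mpr (Or.inl hc))).mul_const
        _).differentiableWithinAt) hUo
  refine hl.eqOn_of_preconnected_of_frequently_eq hr hUc (z₀ := 1) (by simp [hU]) ?_ hb
  have ht : Tendsto (fun x : ℝ => (x : ℂ)) (𝓝[≠] 1) (𝓝[≠] 1) := by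
    refine tendsto_nhdsWithin_iff.mpr ⟨?_, ?_⟩
    · exact tendsto_nhdsWithin_of_tendsto_nhds (by
        simpa using Complex.continuous_ofReal.tendsto 1)
    · filter_upwards [self_mem_nhdsWithin] with x hx
      simpa using hx
  refine ht.frequently (Eventually.frequently ?_)
  filter_upwards [mem_nhdsWithin_of_mem_nhds (lt_mem_nhds (zero_lt_one' ℝ))] with x hx
  rw [Complex.integral_cpow_mul_exp_neg_mul_Ioi ha hx, one_div, Complex.inv_cpow _ _
    (by rw [Complex.arg_ofReal_of_nonneg hx.le]; exact Real.pi_ne_zero.symm), Complex.cpow_neg]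

theorem integral_truncPow_div_Gamma_mul_exp {z b : ℂ} (hz : -1 < z.re) (hb : 0 < b.re) :
    ∫ s : ℝ, truncPow z s / Complex.Gamma (z + 1) * Complex.exp (-(b * s)) = b ^ (-(z + 1)) := by
  have hz' : 0 < (z + 1).re := by simp; linarith
  have hG : Complex.Gamma (z + 1) ≠ 0 := Complex.Gamma_ne_zero_of_re_pos hz'
  have h0 : (fun s : ℝ => truncPow z s / Complex.Gamma (z + 1) * Complex.exp (-(b * s))) =
      (Set.Ioi (0 : ℝ)).indicator fun s : ℝ =>
        (Complex.Gamma (z + 1))⁻¹ * ((s : ℂ) ^ (z + 1 - 1) * Complex.exp (-(b * s))) := by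
    ext s
    by_cases hs : 0 < s
    · simp only [truncPow, hs, if_true, Set.indicator_of_mem (Set.mem_Ioi.mpr hs),
        add_sub_cancel_right]
      ring
    · simp [truncPow, hs]
  rw [h0, integral_indicator measurableSet_Ioi, integral_const_mul,
    integral_cpow_mul_exp_neg_mul_Ioi_of_re_pos hz' hb]
  field_simp

theorem integrable_truncPow_div_Gamma_mul_exp {z b : ℂ} (hz : -1 < z.re) (hb : 0 < b.re) :
    Integrable fun s : ℝ => truncPow z s / Complex.Gamma (z + 1) * Complex.exp (-(b * s)) := by
  -- The integral of a non-integrable function is `0` by convention, and this one is not `0`.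
  refine Integrable.of_integral_ne_zero ?_
  rw [integral_truncPow_div_Gamma_mul_exp hz hb, Complex.cpow_ne_zero_iff]
  refine Or.inl fun h => ?_
  simp [h] at hb

theorem kernelK_mul_exp_eq_prod {n : ℕ} (z b : Fin (n + 1) → ℂ) (t : Fin (n + 1) → ℝ) :
    kernelK z t * Complex.exp (-∑ j, b j * t j) =
      ∏ j, (truncPow (z j) (t j) / Complex.Gamma (z j + 1) * Complex.exp (-(b j * t j))) := by
  rw [Finset.prod_mul_distrib, ← Complex.exp_sum, Finset.sum_neg_distrib, kernelK]

theorem integrable_kernelK_mul_exp {n : ℕ} {z b : Fin (n + 1) → ℂ} (hz : ∀ j, -1 < (z j).re)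
    (hb : ∀ j, 0 < (b j).re) :
    Integrable fun t : Fin (n + 1) → ℝ => kernelK z t * Complex.exp (-∑ j, b j * t j) := by
  simp_rw [kernelK_mul_exp_eq_prod]
  exact Integrable.fintype_prod (f := fun j (s : ℝ) =>
    truncPow (z j) s / Complex.Gamma (z j + 1) * Complex.exp (-(b j * s)))
    fun j => integrable_truncPow_div_Gamma_mul_exp (hz j) (hb j)

theorem integral_kernelK_mul_exp {n : ℕ} {z b : Fin (n + 1) → ℂ} (hz : ∀ j, -1 < (z j).re)
    (hb : ∀ j, 0 < (b j).re) :
    ∫ t : Fin (n + 1) → ℝ, kernelK z t * Complex.exp (-∑ j, b j * t j) =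
      ∏ j, b j ^ (-(z j + 1)) := by
  simp_rw [kernelK_mul_exp_eq_prod]
  rw [integral_fintype_prod_volume_eq_prod (fun j (s : ℝ) =>
    truncPow (z j) s / Complex.Gamma (z j + 1) * Complex.exp (-(b j * s)))]
  exact Finset.prod_congr rfl fun j _ => integral_truncPow_div_Gamma_mul_exp (hz j) (hb j)

/-! ### The regularised symbol as a damped truncated power -/

theorem kernelK_eq_zero_of_not_pos {n : ℕ} (z : Fin (n + 1) → ℂ) {t : Fin (n + 1) → ℝ}
    (ht : ¬ ∀ j, 0 < t j) : kernelK z t = 0 := by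
  push Not at ht
  obtain ⟨j, hj⟩ := ht
  exact Finset.prod_eq_zero (Finset.mem_univ j) (by simp [truncPow, not_lt.mpr hj])

theorem truncPowDist_apply_eq_integral {d n : ℕ} (M : Matrix (Fin d) (Fin (n + 1)) ℝ)
    (hM : InOpenHalfSpace M) (z : Fin (n + 1) → ℂ) (hz : ∀ j, -1 < (z j).re)
    (φ : 𝓢(EuclideanSpace ℝ (Fin d), ℂ)) :
    truncPowDist M hM z hz φ = ∫ t, kernelK z t * φ (mulV M t) := by
  rw [truncPowDist_apply]
  refine setIntegral_eq_integral_of_forall_compl_eq_zero fun t ht => ?_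
  rw [kernelK_eq_zero_of_not_pos z fun h => ht fun j => (h j).le, zero_mul]

theorem integral_cpowProd_mul {d n : ℕ} (M : Matrix (Fin d) (Fin (n + 1)) ℝ)
    {z : Fin (n + 1) → ℂ} (hz : ∀ j, -1 < (z j).re) {ε : Fin (n + 1) → ℝ} (hε : ∀ j, 0 < ε j)
    (φ : 𝓢(EuclideanSpace ℝ (Fin d), ℂ)) :
    ∫ w, cpowProd M z ε w * φ w =
      ∫ t, kernelK z t * Complex.exp (-∑ j, (ε j : ℂ) * t j) * fourierS d φ (mulV M t) := by
  have hexp : ∀ (w : EuclideanSpace ℝ (Fin d)) (t : Fin (n + 1) → ℝ),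
      Complex.exp (-∑ j, ((ε j : ℂ) + Complex.I * (inner ℝ w (dir M j) : ℝ)) * t j) =
        Complex.exp (-∑ j, (ε j : ℂ) * t j) *
          Complex.exp (-Complex.I * (inner ℝ (mulV M t) w : ℝ)) := by
    intro w t
    rw [← Complex.exp_add, real_inner_comm, inner_mulV]
    congr 1
    push_cast
    rw [Finset.mul_sum, ← Finset.sum_neg_distrib, ← Finset.sum_neg_distrib,
      ← Finset.sum_add_distrib]
    exact Finset.sum_congr rfl fun j _ => by ring
  have hint : Integrable (Function.uncurry fun (w : EuclideanSpace ℝ (Fin d))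
      (t : Fin (n + 1) → ℝ) => φ w * (kernelK z t * Complex.exp (-∑ j, (ε j : ℂ) * t j)) *
        Complex.exp (-Complex.I * (inner ℝ (mulV M t) w : ℝ))) := by
    have h := (φ.integrable (μ := volume)).mul_prod (ν := volume)
      (integrable_kernelK_mul_exp (b := fun j => (ε j : ℂ)) hz (by simpa using hε))
    -- The oscillating factor has modulus `1`.
    refine h.mul_bdd (c := 1) ?_ (Eventually.of_forall fun p => ?_)
    · have := continuous_mulV M
      exact Continuous.aestronglyMeasurable (by fun_prop)
    · rw [Complex.norm_exp]
      simp
  calc ∫ w, cpowProd M z ε w * φ w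
      = ∫ w, ∫ t, φ w * (kernelK z t * Complex.exp (-∑ j, (ε j : ℂ) * t j)) *
          Complex.exp (-Complex.I * (inner ℝ (mulV M t) w : ℝ)) := by
        refine integral_congr_ae (Eventually.of_forall fun w => ?_)
        have := integral_kernelK_mul_exp (z := z)
          (b := fun j => (ε j : ℂ) + Complex.I * (inner ℝ w (dir M j) : ℝ)) hz (by simpa using hε)
        simp only [cpowProd]
        rw [← this, mul_comm, ← integral_const_mul]
        refine integral_congr_ae (Eventually.of_forall fun t => ?_)
        simp only [hexp]
        ring
    _ = ∫ t, ∫ w, φ w * (kernelK z t * Complex.exp (-∑ j, (ε j : ℂ) * t j)) *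
          Complex.exp (-Complex.I * (inner ℝ (mulV M t) w : ℝ)) := integral_integral_swap hint
    _ = _ := by
        refine integral_congr_ae (Eventually.of_forall fun t => ?_)
        simp only [fourierS_apply]
        rw [← integral_const_mul]
        refine integral_congr_ae (Eventually.of_forall fun w => ?_)
        simp only
        ring

/-! ### Boundary values -/

theorem tendsto_integral_kernelK_mul_exp {d n : ℕ} {M : Matrix (Fin d) (Fin (n + 1)) ℝ}
    (hM : InOpenHalfSpace M) {z : Fin (n + 1) → ℂ} (hz : ∀ j, -1 < (z j).re)
    (ψ : 𝓢(EuclideanSpace ℝ (Fin d), ℂ)) :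
    Tendsto (fun ε : Fin (n + 1) → ℝ =>
        ∫ t, kernelK z t * Complex.exp (-∑ j, (ε j : ℂ) * t j) * ψ (mulV M t))
      (𝓝[{ε | ∀ j, 0 < ε j}] 0) (𝓝 (∫ t, kernelK z t * ψ (mulV M t))) := by
  refine tendsto_integral_filter_of_dominated_convergence
    (fun t => ‖kernelK z t * ψ (mulV M t)‖) ?_ ?_ (integrable_kernelK hM hz ψ).norm ?_
  · refine Eventually.of_forall fun ε => Measurable.aestronglyMeasurable ?_
    refine ((measurable_kernelK z).mul (Continuous.measurable (by fun_prop))).mul ?_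
    exact (ψ.continuous.comp (continuous_mulV M)).measurable
  · filter_upwards [self_mem_nhdsWithin] with ε hε
    refine Eventually.of_forall fun t => ?_
    by_cases ht : ∀ j, 0 < t j
    · rw [mul_right_comm, norm_mul _ (Complex.exp _)]
      refine mul_le_of_le_one_right (norm_nonneg _) ?_
      rw [Complex.norm_exp, Real.exp_le_one_iff]
      simp only [Complex.neg_re, Complex.re_sum, Complex.re_ofReal_mul, Complex.ofReal_re]
      exact neg_nonpos.mpr (Finset.sum_nonneg fun j _ => mul_nonneg (hε j).le (ht j).le)
    · simp [kernelK_eq_zero_of_not_pos z ht]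
  · refine Eventually.of_forall fun t => tendsto_nhdsWithin_of_tendsto_nhds ?_
    have hc : Continuous fun ε : Fin (n + 1) → ℝ =>
        kernelK z t * Complex.exp (-∑ j, (ε j : ℂ) * t j) * ψ (mulV M t) := by fun_prop
    simpa using hc.tendsto 0

theorem isCpowProdDist_fourierD_truncPowDist {d n : ℕ} {M : Matrix (Fin d) (Fin (n + 1)) ℝ}
    (hM : InOpenHalfSpace M) {z : Fin (n + 1) → ℂ} (hz : ∀ j, -1 < (z j).re) :
    IsCpowProdDist M z (fourierD (truncPowDist M hM z hz)) := by
  intro φ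
  rw [fourierD_apply, truncPowDist_apply_eq_integral]
  refine (tendsto_integral_kernelK_mul_exp hM hz (fourierS d φ)).congr' ?_
  filter_upwards [self_mem_nhdsWithin] with ε hε
  exact (integral_cpowProd_mul M hz hε φ).symm

/-! ### The case of an integrable limit -/

/-- Powers with exponent of nonpositive real part decrease in the modulus of the base, up to a
constant accounting for the arguments. -/
theorem norm_cpow_neg_le {a b c : ℂ} (ha : 0 ≤ a.re) (hc : c ≠ 0) (hcb : ‖c‖ ≤ ‖b‖) :
    ‖b ^ (-a)‖ ≤ Real.exp (2 * Real.pi * |a.im|) * ‖c ^ (-a)‖ := by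
  have hc' : 0 < ‖c‖ := norm_pos_iff.mpr hc
  have hb : b ≠ 0 := norm_pos_iff.mp (hc'.trans_le hcb)
  have harg : ∀ x : ℂ, |x.arg * a.im| ≤ Real.pi * |a.im| := fun x => by
    rw [abs_mul]
    exact mul_le_mul_of_nonneg_right (Complex.abs_arg_le_pi x) (abs_nonneg _)
  rw [Complex.norm_cpow_of_ne_zero hb, Complex.norm_cpow_of_ne_zero hc, div_eq_mul_inv,
    div_eq_mul_inv, ← Real.exp_neg, ← Real.exp_neg, mul_left_comm, ← Real.exp_add]
  refine mul_le_mul ?_ ?_ (Real.exp_pos _).le (by positivity)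
  · exact Real.rpow_le_rpow_of_nonpos hc' hcb (by simpa using ha)
  · rw [Real.exp_le_exp, Complex.neg_im]
    linarith [(abs_le.mp (harg b)).2, (abs_le.mp (harg c)).1]

theorem ae_inner_ne_zero {E : Type*} [NormedAddCommGroup E] [InnerProductSpace ℝ E]
    [FiniteDimensional ℝ E] [MeasurableSpace E] [BorelSpace E] {m : E} (hm : m ≠ 0) :
    ∀ᵐ w : E, inner ℝ w m ≠ 0 := by
  have h : (LinearMap.ker (innerSL ℝ m : E →ₗ[ℝ] ℝ)) ≠ ⊤ := fun h => by
    have : m ∈ LinearMap.ker (innerSL ℝ m : E →ₗ[ℝ] ℝ) := h ▸ Submodule.mem_top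
    exact hm (by simpa using this)
  refine measure_mono_null (fun w hw => ?_) (Measure.addHaar_submodule volume _ h)
  have hw' : inner ℝ w m = 0 := by simpa using hw
  simpa [real_inner_comm] using hw'

theorem norm_cpowProd_le {d n : ℕ} (M : Matrix (Fin d) (Fin (n + 1)) ℝ) {z : Fin (n + 1) → ℂ}
    (hz : ∀ j, -1 < (z j).re) (ε : Fin (n + 1) → ℝ) {w : EuclideanSpace ℝ (Fin d)}
    (hw : ∀ j, inner ℝ w (dir M j) ≠ 0) :
    ‖cpowProd M z ε w‖ ≤
      (∏ j, Real.exp (2 * Real.pi * |(z j + 1).im|)) * ‖cpowProd M z 0 w‖ := by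
  simp only [cpowProd, norm_prod]
  rw [← Finset.prod_mul_distrib]
  refine Finset.prod_le_prod (fun _ _ => norm_nonneg _) fun j _ => ?_
  refine norm_cpow_neg_le (by simp; linarith [hz j]) (by simpa using hw j) ?_
  have := Complex.abs_im_le_norm ((ε j : ℂ) + Complex.I * (inner ℝ w (dir M j) : ℝ))
  simpa using this

theorem tendsto_cpowProd {d n : ℕ} (M : Matrix (Fin d) (Fin (n + 1)) ℝ) (z : Fin (n + 1) → ℂ)
    {w : EuclideanSpace ℝ (Fin d)} (hw : ∀ j, inner ℝ w (dir M j) ≠ 0) :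
    Tendsto (fun ε => cpowProd M z ε w) (𝓝 0) (𝓝 (cpowProd M z 0 w)) := by
  refine tendsto_finsetProd _ fun j _ => ?_
  have hc : Continuous fun ε : Fin (n + 1) → ℝ =>
      (ε j : ℂ) + Complex.I * (inner ℝ w (dir M j) : ℝ) := by fun_prop
  refine (hc.tendsto 0).cpow tendsto_const_nhds ?_
  exact Complex.mem_slitPlane_iff.mpr (Or.inr (by simpa using hw j))

theorem tendsto_integral_cpowProd_mul_of_integrable {d n : ℕ}
    {M : Matrix (Fin d) (Fin (n + 1)) ℝ} (hM : ∀ j, dir M j ≠ 0) {z : Fin (n + 1) → ℂ}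
    (hz : ∀ j, -1 < (z j).re) (φ : 𝓢(EuclideanSpace ℝ (Fin d), ℂ))
    (hφ : Integrable fun w => cpowProd M z 0 w * φ w) :
    Tendsto (fun ε : Fin (n + 1) → ℝ => ∫ w, cpowProd M z ε w * φ w)
      (𝓝[{ε | ∀ j, 0 < ε j}] 0) (𝓝 (∫ w, cpowProd M z 0 w * φ w)) := by
  have hae : ∀ᵐ w : EuclideanSpace ℝ (Fin d), ∀ j, inner ℝ w (dir M j) ≠ 0 :=
    ae_all_iff.mpr fun j => ae_inner_ne_zero (hM j)
  refine tendsto_integral_filter_of_dominated_convergence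
    (fun w => (∏ j, Real.exp (2 * Real.pi * |(z j + 1).im|)) * ‖cpowProd M z 0 w * φ w‖)
    ?_ ?_ (hφ.norm.const_mul _) ?_
  · filter_upwards [self_mem_nhdsWithin] with ε hε
    exact (integrable_cpowProd M z hz hε φ).aestronglyMeasurable
  · refine Eventually.of_forall fun ε => ?_
    filter_upwards [hae] with w hw
    rw [norm_mul, norm_mul, ← mul_assoc]
    exact mul_le_mul_of_nonneg_right (norm_cpowProd_le M hz ε hw) (norm_nonneg _)
  · filter_upwards [hae] with w hw
    exact (tendsto_nhdsWithin_of_tendsto_nhds (tendsto_cpowProd M z hw)).mul_const _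

theorem neBot_nhdsWithin_pos (ι : Type*) :
    (𝓝[{ε : ι → ℝ | ∀ j, 0 < ε j}] 0).NeBot := by
  rw [← mem_closure_iff_nhdsWithin_neBot]
  have h : {ε : ι → ℝ | ∀ j, 0 < ε j} = Set.univ.pi fun _ => Set.Ioi 0 := by
    ext; simp
  rw [h, closure_pi_set]
  exact fun j _ => by rw [closure_Ioi]; exact Set.mem_Ici.mpr le_rfl

theorem prod_one_div_cpow_eq_cpowProd {d n : ℕ} (M : Matrix (Fin d) (Fin (n + 1)) ℝ)
    (z : Fin (n + 1) → ℂ) (w : EuclideanSpace ℝ (Fin d)) :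
    ∏ j, (1 / (Complex.I * (inner ℝ w (dir M j) : ℝ)) ^ (z j + 1)) = cpowProd M z 0 w := by
  simp only [cpowProd, Pi.zero_apply, Complex.ofReal_zero, zero_add, Complex.cpow_neg, one_div]

end ComplexBoxSpline

theorem mainTheorem5 {d n : ℕ} (M : Matrix (Fin d) (Fin (n + 1)) ℝ)
    (hdir : ComplexBoxSpline.IsDirectionSet M) (hM : ComplexBoxSpline.InOpenHalfSpace M)
    (z : Fin (n + 1) → ℂ) (hz : ∀ j, -1 < (z j).re) :
    ComplexBoxSpline.IsCpowProdDist M z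
      (ComplexBoxSpline.fourierD (ComplexBoxSpline.truncPowDist M hM z hz)) ∧
    ∀ φ : 𝓢(EuclideanSpace ℝ (Fin d), ℂ),
      Integrable (fun w : EuclideanSpace ℝ (Fin d) =>
        (∏ j, (1 / (Complex.I * (inner ℝ w (ComplexBoxSpline.dir M j) : ℝ)) ^ (z j + 1))) * φ w) →
      ComplexBoxSpline.fourierD (ComplexBoxSpline.truncPowDist M hM z hz) φ =
        ∫ w : EuclideanSpace ℝ (Fin d),
          (∏ j, (1 / (Complex.I * (inner ℝ w (ComplexBoxSpline.dir M j) : ℝ)) ^ (z j + 1))) * φ w := by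
  have hlim := ComplexBoxSpline.isCpowProdDist_fourierD_truncPowDist hM hz
  refine ⟨hlim, fun φ hφ => ?_⟩
  simp_rw [ComplexBoxSpline.prod_one_div_cpow_eq_cpowProd] at hφ ⊢
  have := ComplexBoxSpline.neBot_nhdsWithin_pos (Fin (n + 1))
  exact tendsto_nhds_unique (hlim φ)
    (ComplexBoxSpline.tendsto_integral_cpowProd_mul_of_integrable hdir.ne_zero hz φ hφ)
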